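/- Let $n\ge 3$ and $s\ge 1$ be integers. For an integer vector $a=(a_1,\dots,a_n)$ with all $a_i>0$ and $\gcd(a_1,\dots,a_n)=1$, let the $s$-Frobenius number $\mathrm F_s(a)$ be the largest integer $b$ for which the equation $a_1z_1+\cdots+a_nz_n=b$ has fewer than $s$ solutions $z\in\mathbb Z_{\ge 0}^n$ (this maximum exists). For a convex body $K\subset\mathbb R^d$ and a $d$-dimensional lattice $L\subset\mathbb R^d$, let the $s$-covering radius $\mu_s(K,L)$ be the smallest $\mu>0$ such that for every $x\in\mathbb R^d$ there are distinct $y_1,\dots,y_s\in L$ with $x\in y_i+\mu K$ for all $i$, and let the absolute $s$-inhomogeneous minimum of $K$ be $$\vartheta_s(K)=\inf_L \frac{\mu_s(K,L)}{\det(L)^{1/d}},$$ where $L$ ranges over all $d$-dimensional lattices in $\mathbb R^d$. Let $S_{n-1}=\{x\in\mathbb R_{\ge 0}^{n-1} : x_1+\cdots+x_{n-1}\le 1\}$ be the standard simplex. Then: (i) For every $a=(a_1,\dots,a_n)\in\mathbb Z_{>0}^n$ with $\gcd(a_1,\dots,a_n)=1$, $$\mathrm F_s(a)\ \ge\ \vartheta_s(S_{n-1})\Big(\prod_{i=1}^n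 a_i\Big)^{\frac1{n-1}}-\sum_{i=1}^n a_i .$$ (ii) For every $\epsilon>0$ and all real numbers $0<\alpha_1\le\cdots\le\alpha_{n-1}$ there is a vector $a=(a_1,\dots,a_n)\in\mathbb Z_{>0}^n$ with $\gcd(a_1,\dots,a_n)=1$ such that $$\Big|\alpha_i-\frac{a_i}{a_n}\Big|<\epsilon\quad(i=1,\dots,n-1)\qquad\text{and}\qquad \frac{\mathrm F_s(a)+\sum_{i=1}^n a_i}{(a_1\cdots a_n)^{1/(n-1)}}<\vartheta_s(S_{n-1})+\epsilon .$$ -/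

import Mathlib

noncomputable section

namespace Knapsack

/-- The knapsack polytope `P(aᵀ, b)`: all real vectors `x ≥ 0` with `∑ aᵢ xᵢ = b`. -/
def polytope {n : ℕ} (a : Fin n → ℤ) (b : ℤ) : Set (Fin n → ℝ) :=
  {x | (∀ i, 0 ≤ x i) ∧ ∑ i, (a i : ℝ) * x i = (b : ℝ)}

/-- The integer points of the knapsack polytope `P(aᵀ, b)`. -/
def integerPoints {n : ℕ} (a : Fin n → ℤ) (b : ℤ) : Set (Fin n → ℤ) :=
  {z | (fun i => (z i : ℝ)) ∈ polytope a b}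

/-- The set of integers `b` such that `P(aᵀ, b)` contains fewer than `s` integer points. -/
def deficientSet {n : ℕ} (s : ℕ) (a : Fin n → ℤ) : Set ℤ :=
  {b | (integerPoints a b).encard < (s : ℕ∞)}

/-- The `s`-Frobenius number of `a`, the largest integer `b` such that `P(aᵀ, b)` contains
fewer than `s` integer points. -/
def frobeniusNumber {n : ℕ} (s : ℕ) (a : Fin n → ℤ) : ℤ :=
  sSup (deficientSet s a)

/-- The `s`-covering radius of `K` with respect to `L`: the smallest `μ > 0` such that every
point `x` of the real span of `L` lies in `yᵢ + μ K` for at least `s` distinct points `yᵢ` of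
`L`. -/
def coveringRadius {E : Type*} [AddCommGroup E] [Module ℝ E]
    (s : ℕ) (K : Set E) (L : Submodule ℤ E) : ℝ :=
  sInf {μ : ℝ | 0 < μ ∧ ∀ x ∈ Submodule.span ℝ (L : Set E),
    ∃ y : Fin s → E, Function.Injective y ∧ (∀ i, y i ∈ L) ∧
      ∀ i, ∃ k ∈ K, x = y i + μ • k}

/-- The absolute `s`-inhomogeneous minimum of `K ⊆ ℝᵈ`: the infimum of
`μ_s(K, L) / det(L)^(1/d)` over all `d`-dimensional lattices `L` in `ℝᵈ`. The covolume is taken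
with respect to Lebesgue measure, so it is the determinant of `L`. -/
def absInhomogeneousMinimum {d : ℕ} (s : ℕ) (K : Set (Fin d → ℝ)) : ℝ :=
  sInf {r : ℝ | ∃ (L : Submodule ℤ (Fin d → ℝ)) (_ : DiscreteTopology L) (_ : IsZLattice ℝ L),
    r = coveringRadius s K L / ZLattice.covolume L ^ (1 / (d : ℝ))}

/-- The standard `d`-dimensional simplex `{x ≥ 0 : x₁ + ⋯ + x_d ≤ 1}` in `ℝᵈ`. -/
def standardSimplex (d : ℕ) : Set (Fin d → ℝ) :=
  {x | (∀ i, 0 ≤ x i) ∧ ∑ i, x i ≤ 1}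

end Knapsack

end

/-! ### Solutions of the knapsack equation versus coverings by a simplex. -/

namespace Knapsack

open Finset

/-! Let `m` be the last entry of `a` and Λ ⊂ ℤᵈ the lattice of all y with m ∣ ∑ aᵢyᵢ. The class of b
modulo m fixes a coset of Λ, and the solutions for b correspond to the nonnegative points of that
coset with ∑ aᵢyᵢ ≤ b. Hence, as in Kannan's theorem for s = 1, F_s(a) + ∑ aᵢ is the s-covering
radius of {x ≥ 0 : ∑ aᵢxᵢ ≤ 1} with respect to Λ; `covering_of_isGreatest` and
`add_sum_le_of_covering` are the two inequalities. Multiplying the i-th coordinate by aᵢ yields the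
standard simplex and a lattice of determinant ∏ aᵢ (`covolume_frobeniusLattice`), so (i) follows by
comparing with the infimum.

For (ii), take a nearly optimal lattice with basis matrix b. The rows of b diag(α)⁻¹ extend to
vectors orthogonal to (α, 1), so the maximal minors of this d × (d + 1) matrix are proportional to
(α, 1). Approximate it by t⁻¹v with v integral and its minors coprime
(`exists_primitive_approximation`), and let a be these minors up to a common sign. Then gcd(a) = 1,
aᵢ/m is close to αᵢ, and the rows of v, being orthogonal to a, give points of Λ which after scaling
form nearly the basis b. Coverings survive small perturbations of the basis at the cost of a
slightly larger dilate (`Covers.eventually`), which bounds F_s(a). -/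

theorem mem_integerPoints {n : ℕ} {a : Fin n → ℤ} {b : ℤ} {z : Fin n → ℤ} :
    z ∈ integerPoints a b ↔ (∀ i, 0 ≤ z i) ∧ ∑ i, a i * z i = b := by
  simp only [integerPoints, polytope, Set.mem_ofPred_eq, Int.cast_nonneg_iff]
  refine and_congr_right fun _ => ?_
  exact_mod_cast Iff.rfl

/-- `b` is not deficient as soon as `s` pairwise distinct solutions exist. -/
theorem notMem_deficientSet_iff {n s : ℕ} {a : Fin n → ℤ} {b : ℤ} :
    b ∉ deficientSet s a ↔ ∃ z : Fin s → Fin n → ℤ, Function.Injective z ∧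
      ∀ k, z k ∈ integerPoints a b := by
  simp only [deficientSet, Set.mem_ofPred_eq, not_lt]
  constructor
  · intro h
    obtain ⟨t, ht, hc⟩ := Set.exists_subset_encard_eq h
    have hfin : t.Finite := Set.finite_of_encard_eq_coe hc
    have hcard : Nat.card t = s := by
      rw [Nat.card_coe_set_eq, Set.ncard, hc, ENat.toNat_natCast]
    have : Finite t := hfin
    let e := (Finite.equivFinOfCardEq hcard).symm
    exact ⟨fun k => (e k : Fin n → ℤ), Subtype.val_injective.comp e.injective,
      fun k => ht (e k).2⟩
  · rintro ⟨z, hz, hm⟩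
    have h1 : (Set.range z).encard = s := by
      rw [← Set.image_univ, hz.encard_image]
      simp
    rw [← h1]
    exact Set.encard_le_encard (Set.range_subset_iff.2 hm)

theorem exists_sum_mul_eq {n : ℕ} {a : Fin n → ℤ} (hg : univ.gcd a = 1) (b : ℤ) :
    ∃ c : Fin n → ℤ, ∑ i, a i * c i = b := by
  obtain ⟨f, hf⟩ := Finset.gcd_eq_sum_mul univ a
  refine ⟨fun i => f i * b, ?_⟩
  rw [hg] at hf
  calc ∑ i, a i * (f i * b) = (∑ i, a i * f i) * b := by
        rw [sum_mul]; exact sum_congr rfl fun i _ => by ring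
    _ = b := by
        have h2 : ∑ i, a i * f i = 1 := by
          rw [hf]
        rw [h2, one_mul]

variable {d s : ℕ} {a : Fin (d + 1) → ℤ}

theorem neg_mem_deficientSet (ha : ∀ i, 0 < a i) (hs : 1 ≤ s) {b : ℤ} (hb : b < 0) :
    b ∈ deficientSet s a := by
  by_contra h
  obtain ⟨z, -, hz⟩ := notMem_deficientSet_iff.1 h
  obtain ⟨h0, h1⟩ := mem_integerPoints.1 (hz ⟨0, hs⟩)
  have : 0 ≤ ∑ i, a i * z ⟨0, hs⟩ i := sum_nonneg fun i _ => mul_nonneg (ha i).le (h0 i)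
  omega

/-- Extends nonnegative integers `y` with `∑ aᵢ yᵢ ≤ b` and `∑ aᵢ yᵢ ≡ b` to a solution. -/
theorem snoc_mem_integerPoints (ha : 0 < a (Fin.last d)) {b : ℤ} {y : Fin d → ℤ}
    (h0 : ∀ i, 0 ≤ y i) (hle : ∑ i : Fin d, a i.castSucc * y i ≤ b)
    (hdvd : a (Fin.last d) ∣ b - ∑ i : Fin d, a i.castSucc * y i) :
    (Fin.snoc (α := fun _ => ℤ) y
      ((b - ∑ i : Fin d, a i.castSucc * y i) / a (Fin.last d))) ∈ integerPoints a b := by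
  rw [mem_integerPoints]
  constructor
  · intro i
    refine Fin.lastCases ?_ (fun j => ?_) i
    · simpa using Int.ediv_nonneg (by omega) ha.le
    · simpa using h0 j
  · rw [Fin.sum_univ_castSucc]
    simp only [Fin.snoc_castSucc, Fin.snoc_last]
    rw [Int.mul_ediv_cancel' hdvd]
    ring

theorem bddAbove_deficientSet (hd : 1 ≤ d) (ha : ∀ i, 0 < a i) (hg : univ.gcd a = 1) :
    BddAbove (deficientSet s a) := by
  set m := a (Fin.last d) with hm
  have hm0 : 0 < m := ha _
  refine ⟨∑ i : Fin d, a i.castSucc * (m + s * m), fun b hb => ?_⟩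
  by_contra hlt
  push Not at hlt
  refine absurd hb (notMem_deficientSet_iff.2 ?_)
  obtain ⟨c, hc⟩ := exists_sum_mul_eq hg b
  -- Residues in [0, m) of a Bézout solution, shifted by multiples of m: the congruence class is
  -- kept, the s vectors are distinct, and entries stay below m + s·m.
  let y : Fin s → Fin d → ℤ := fun k i => c i.castSucc % m + k * m
  refine ⟨fun k => Fin.snoc (α := fun _ => ℤ) (y k)
      ((b - ∑ i : Fin d, a i.castSucc * y k i) / m), ?_, fun k => ?_⟩
  · intro k l hkl
    have := congrFun hkl (Fin.castSucc ⟨0, hd⟩)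
    simp only [Fin.snoc_castSucc, y, add_right_inj] at this
    have := mul_right_cancel₀ hm0.ne' this
    exact Fin.ext (by exact_mod_cast this)
  · refine snoc_mem_integerPoints hm0 (fun i => ?_) ?_ ?_
    · have := Int.emod_nonneg (c i.castSucc) hm0.ne'
      positivity
    · refine le_trans (sum_le_sum fun i _ => ?_) hlt.le
      refine mul_le_mul_of_nonneg_left ?_ (ha _).le
      have h1 := Int.emod_lt_of_pos (c i.castSucc) hm0
      have h2 : (k : ℤ) ≤ s := by exact_mod_cast k.2.le
      have := mul_le_mul_of_nonneg_right h2 hm0.le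
      simp only [y]
      linarith
    · rw [← hc, Fin.sum_univ_castSucc, add_sub_right_comm, ← sum_sub_distrib]
      refine dvd_add (dvd_sum fun i _ => ?_) (Dvd.intro _ rfl)
      rw [← mul_sub]
      refine Dvd.dvd.mul_left ?_ _
      simp only [y]
      rw [← sub_sub]
      exact dvd_sub (Int.dvd_self_sub_emod) (Dvd.intro_left _ rfl)

/-- Rules out the default value of `sSup` on ℤ, which is taken for empty or unbounded sets. -/
theorem isGreatest_frobeniusNumber (hd : 1 ≤ d) (hs : 1 ≤ s) (ha : ∀ i, 0 < a i)
    (hg : univ.gcd a = 1) : IsGreatest (deficientSet s a) (frobeniusNumber s a) :=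
  ⟨Int.csSup_mem ⟨-1, neg_mem_deficientSet ha hs (by norm_num)⟩ (bddAbove_deficientSet hd ha hg),
    fun _ hb => le_csSup (bddAbove_deficientSet hd ha hg) hb⟩

/-- If the dilate by `μ` of the simplex `{x ≥ 0 : ∑ aᵢ xᵢ ≤ 1}` covers space `s` times by
translates along the lattice `{y : a_last ∣ ∑ aᵢ yᵢ}`, then `b + ∑ aᵢ ≤ μ` for deficient `b`. -/
theorem add_sum_le_of_covering (ha : ∀ i, 0 < a i) (hg : univ.gcd a = 1) {μ : ℝ}
    (hcov : ∀ x : Fin d → ℝ, ∃ y : Fin s → Fin d → ℤ, Function.Injective y ∧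
      ∀ k, a (Fin.last d) ∣ ∑ i : Fin d, a i.castSucc * y k i ∧ (∀ i, (y k i : ℝ) ≤ x i) ∧
        ∑ i : Fin d, (a i.castSucc : ℝ) * (x i - y k i) ≤ μ)
    {b : ℤ} (hb : b ∈ deficientSet s a) : (b : ℝ) + ∑ i, (a i : ℝ) ≤ μ := by
  by_contra hlt
  push Not at hlt
  refine absurd hb (notMem_deficientSet_iff.2 ?_)
  have hm0 := ha (Fin.last d)
  obtain ⟨c, hc⟩ := exists_sum_mul_eq hg b
  set A : ℝ := ∑ i : Fin d, (a i.castSucc : ℝ) with hA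
  have hA0 : 0 ≤ A := sum_nonneg fun i _ => by exact_mod_cast (ha _).le
  rw [Fin.sum_univ_castSucc, ← hA] at hlt
  -- The covering is applied at c + 1 - δ: an integer y ≤ c + 1 - δ satisfies y ≤ c, so z = c - y is
  -- nonnegative. The shift by almost 1 gains almost `A`; the slack in `hlt` pays for the loss δA.
  obtain ⟨δ, hδ0, hδ⟩ : ∃ δ : ℝ, 0 < δ ∧ μ + δ * A < b + (A + a (Fin.last d)) := by
    refine ⟨(b + (A + a (Fin.last d)) - μ) / (A + 1), div_pos (by linarith) (by linarith), ?_⟩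
    have : (b + (A + a (Fin.last d)) - μ) / (A + 1) * A < b + (A + a (Fin.last d)) - μ := by
      rw [div_mul_eq_mul_div, div_lt_iff₀ (by linarith)]
      nlinarith
    linarith
  obtain ⟨y, hinj, hy⟩ := hcov fun i => c i.castSucc + 1 - δ
  let z : Fin s → Fin d → ℤ := fun k i => c i.castSucc - y k i
  have hdvd : ∀ k, a (Fin.last d) ∣ b - ∑ i : Fin d, a i.castSucc * z k i := fun k => by
    have : b - ∑ i : Fin d, a i.castSucc * z k i =
        a (Fin.last d) * c (Fin.last d) + ∑ i : Fin d, a i.castSucc * y k i := by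
      rw [← hc, Fin.sum_univ_castSucc]
      simp only [z, mul_sub, sum_sub_distrib]
      ring
    rw [this]
    exact dvd_add (Dvd.intro _ rfl) (hy k).1
  refine ⟨fun k => Fin.snoc (α := fun _ => ℤ) (z k)
      ((b - ∑ i : Fin d, a i.castSucc * z k i) / a (Fin.last d)), ?_, fun k => ?_⟩
  · intro k l hkl
    refine hinj (funext fun i => ?_)
    have := congrFun hkl (Fin.castSucc i)
    simp only [Fin.snoc_castSucc, z] at this
    omega
  · refine snoc_mem_integerPoints hm0 (fun i => ?_) ?_ (hdvd k)
    · have h1 := (hy k).2.1 i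
      have h2 : ((y k i : ℤ) : ℝ) < ((c i.castSucc + 1 : ℤ) : ℝ) := by push_cast; linarith
      have h3 : y k i < c i.castSucc + 1 := by exact_mod_cast h2
      simp only [z]
      omega
    · have h1 := (hy k).2.2
      have h2 : ∑ i : Fin d, (a i.castSucc : ℝ) * (c i.castSucc + 1 - δ - y k i) =
          ((∑ i : Fin d, a i.castSucc * z k i : ℤ) : ℝ) + A - δ * A := by
        push_cast
        rw [hA, mul_sum, ← sum_add_distrib, ← sum_sub_distrib]
        refine sum_congr rfl fun i _ => ?_
        simp only [z]
        push_cast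
        ring
      rw [h2] at h1
      have h3 : ((∑ i : Fin d, a i.castSucc * z k i : ℤ) : ℝ) < ((b + a (Fin.last d) : ℤ) : ℝ) := by
        push_cast at h1 ⊢
        linarith
      have h4 : ∑ i : Fin d, a i.castSucc * z k i < b + a (Fin.last d) := by exact_mod_cast h3
      -- The remainder b - ∑ aᵢzᵢ is a multiple of m exceeding -m, hence nonnegative.
      obtain ⟨q, hq⟩ := hdvd k
      have : -1 < q := by
        by_contra h
        push Not at h
        nlinarith
      nlinarith

/-- The `s`-Frobenius number yields a covering. -/
theorem covering_of_isGreatest (ha : ∀ i, 0 < a i) {F : ℤ} (hF : IsGreatest (deficientSet s a) F)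
    (x : Fin d → ℝ) : ∃ y : Fin s → Fin d → ℤ, Function.Injective y ∧
      ∀ k, a (Fin.last d) ∣ ∑ i : Fin d, a i.castSucc * y k i ∧ (∀ i, (y k i : ℝ) ≤ x i) ∧
        ∑ i : Fin d, (a i.castSucc : ℝ) * (x i - y k i) ≤ F + ∑ i, (a i : ℝ) := by
  have hm0 := ha (Fin.last d)
  set m := a (Fin.last d) with hm
  set r : ℤ := ∑ i : Fin d, a i.castSucc * ⌊x i⌋ with hr
  -- The unique integer in (F, F + m] congruent to r modulo m; being above F, it has s solutions.
  set b : ℤ := F + m - (F + m - r) % m with hb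
  have hb1 : F < b := by have := Int.emod_lt_of_pos (F + m - r) hm0; omega
  have hb2 : b ≤ F + m := by have := Int.emod_nonneg (F + m - r) hm0.ne'; omega
  have hb3 : m ∣ b - r := by
    have : b - r = (F + m - r) - (F + m - r) % m := by omega
    rw [this]
    exact Int.dvd_self_sub_emod
  obtain ⟨z, hinj, hz⟩ := notMem_deficientSet_iff.1 (fun h => absurd (hF.2 h) (not_le.2 hb1))
  have hz' := fun k => mem_integerPoints.1 (hz k)
  simp only [Fin.sum_univ_castSucc, ← hm] at hz' ⊢
  refine ⟨fun k i => ⌊x i⌋ - z k i.castSucc, fun k l hkl => hinj ?_, fun k => ⟨?_, fun i => ?_, ?_⟩⟩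
  · have h1 : ∀ i : Fin d, z k i.castSucc = z l i.castSucc := fun i => by
      have := congrFun hkl i
      simp only at this
      omega
    funext i
    refine Fin.lastCases ?_ h1 i
    have h2 := (hz' k).2.trans (hz' l).2.symm
    simp only [h1, add_right_inj] at h2
    exact mul_left_cancel₀ hm0.ne' h2
  · have : ∑ i : Fin d, a i.castSucc * (⌊x i⌋ - z k i.castSucc) =
        m * z k (Fin.last d) - (b - r) := by
      rw [← (hz' k).2, hr]
      simp only [mul_sub, sum_sub_distrib]
      ring
    rw [this]
    exact dvd_sub (Dvd.intro _ rfl) hb3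
  · have h1 := Int.floor_le (x i)
    have h2 : (0 : ℝ) ≤ z k i.castSucc := by exact_mod_cast (hz' k).1 i.castSucc
    push_cast
    linarith
  -- Rounding xᵢ down costs at most aᵢ, and b ≤ F + m costs one more m: together the term ∑ aᵢ.
  · have h1 : ∑ i : Fin d, (a i.castSucc : ℝ) * (x i - ((⌊x i⌋ - z k i.castSucc : ℤ) : ℝ)) ≤
        ∑ i : Fin d, ((a i.castSucc : ℝ) + (a i.castSucc : ℝ) * z k i.castSucc) := by
      refine sum_le_sum fun i _ => ?_
      have h1 := (Int.lt_floor_add_one (x i)).le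
      have h2 : (0 : ℝ) < a i.castSucc := by exact_mod_cast ha _
      push_cast
      nlinarith
    refine h1.trans ?_
    rw [sum_add_distrib]
    have h3 : (0 : ℝ) ≤ z k (Fin.last d) := by exact_mod_cast (hz' k).1 _
    have h4 : ∑ i : Fin d, (a i.castSucc : ℝ) * z k i.castSucc + m * z k (Fin.last d) = b := by
      exact_mod_cast (hz' k).2
    have h5 : (b : ℝ) ≤ F + m := by exact_mod_cast hb2
    have h6 : (0 : ℝ) < m := by exact_mod_cast hm0
    nlinarith

end Knapsack

/-! ### The Frobenius lattice, its determinant, and the lower bound. -/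

namespace Knapsack

open Finset Module

theorem coveringRadius_nonneg {E : Type*} [AddCommGroup E] [Module ℝ E] (s : ℕ) (K : Set E)
    (L : Submodule ℤ E) : 0 ≤ coveringRadius s K L :=
  Real.sInf_nonneg fun _ h => h.1.le

theorem coveringRadius_le {E : Type*} [AddCommGroup E] [Module ℝ E] {s : ℕ} {K : Set E}
    {L : Submodule ℤ E} {μ : ℝ} (hμ : 0 < μ) (h : ∀ x, ∃ y : Fin s → E, Function.Injective y ∧
      (∀ i, y i ∈ L) ∧ ∀ i, ∃ k ∈ K, x = y i + μ • k) : coveringRadius s K L ≤ μ :=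
  csInf_le ⟨0, fun _ h => h.1.le⟩ ⟨hμ, fun x _ => h x⟩

theorem absInhomogeneousMinimum_le {d s : ℕ} {K : Set (Fin d → ℝ)} (L : Submodule ℤ (Fin d → ℝ))
    [DiscreteTopology L] [IsZLattice ℝ L] :
    absInhomogeneousMinimum s K ≤ coveringRadius s K L / ZLattice.covolume L ^ (1 / (d : ℝ)) := by
  refine csInf_le ⟨0, ?_⟩ ⟨L, inferInstance, inferInstance, rfl⟩
  rintro _ ⟨L, _, _, rfl⟩
  exact div_nonneg (coveringRadius_nonneg _ _ _)
    (Real.rpow_nonneg (ZLattice.covolume_pos L).le _)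

theorem mem_smul_standardSimplex {d : ℕ} {μ : ℝ} (hμ : 0 < μ) {x y : Fin d → ℝ} :
    (∃ k ∈ standardSimplex d, x = y + μ • k) ↔ (∀ i, y i ≤ x i) ∧ ∑ i, (x i - y i) ≤ μ := by
  constructor
  · rintro ⟨k, ⟨h0, h1⟩, rfl⟩
    simp only [Pi.add_apply, Pi.smul_apply, smul_eq_mul, le_add_iff_nonneg_right,
      add_sub_cancel_left, ← mul_sum]
    exact ⟨fun i => mul_nonneg hμ.le (h0 i), by nlinarith⟩
  · rintro ⟨h0, h1⟩
    refine ⟨μ⁻¹ • (x - y), ⟨fun i => ?_, ?_⟩, ?_⟩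
    · simp only [Pi.smul_apply, Pi.sub_apply, smul_eq_mul]
      exact mul_nonneg (inv_nonneg.2 hμ.le) (sub_nonneg.2 (h0 i))
    · simp only [Pi.smul_apply, Pi.sub_apply, smul_eq_mul, ← mul_sum]
      rw [inv_mul_le_iff₀ hμ, mul_one]
      exact h1
    · rw [smul_inv_smul₀ hμ.ne']
      simp

variable {d s : ℕ}

/-- The embedding `z ↦ (aᵢ zᵢ)ᵢ` of `ℤᵈ` into `ℝᵈ`. -/
def scaleMap (a : Fin (d + 1) → ℤ) : (Fin d → ℤ) →ₗ[ℤ] (Fin d → ℝ) where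
  toFun z i := a i.castSucc * z i
  map_add' z w := by ext i; simp [mul_add]
  map_smul' c z := by ext i; simp; ring

theorem scaleMap_apply (a : Fin (d + 1) → ℤ) (z : Fin d → ℤ) (i : Fin d) :
    scaleMap a z i = a i.castSucc * z i := rfl

/-- The residue of `∑ aᵢ zᵢ` modulo the last entry of `a`. -/
def residueMap (a : Fin (d + 1) → ℤ) : (Fin d → ℤ) →ₗ[ℤ] ZMod (a (Fin.last d)).natAbs where
  toFun z := ((∑ i : Fin d, a i.castSucc * z i : ℤ) : ZMod (a (Fin.last d)).natAbs)
  map_add' z w := by simp [mul_add, sum_add_distrib]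
  map_smul' c z := by
    simp only [Pi.smul_apply, smul_eq_mul, mul_left_comm, ← mul_sum]
    simp

theorem mem_ker_residueMap {a : Fin (d + 1) → ℤ} {z : Fin d → ℤ} :
    z ∈ LinearMap.ker (residueMap a) ↔ a (Fin.last d) ∣ ∑ i : Fin d, a i.castSucc * z i := by
  rw [LinearMap.mem_ker]
  change (((∑ i : Fin d, a i.castSucc * z i : ℤ)) : ZMod (a (Fin.last d)).natAbs) = 0 ↔ _
  rw [ZMod.intCast_zmod_eq_zero_iff_dvd, Int.natAbs_dvd]

theorem residueMap_surjective {a : Fin (d + 1) → ℤ} (hg : univ.gcd a = 1) :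
    Function.Surjective (residueMap a) := fun r => by
  obtain ⟨r, rfl⟩ := ZMod.intCast_surjective r
  obtain ⟨c, hc⟩ := exists_sum_mul_eq hg r
  refine ⟨fun i => c i.castSucc, ?_⟩
  change (((∑ i : Fin d, a i.castSucc * c i.castSucc : ℤ)) : ZMod (a (Fin.last d)).natAbs) = _
  rw [← hc, Fin.sum_univ_castSucc, eq_comm, ZMod.intCast_eq_intCast_iff_dvd_sub]
  rw [Int.natAbs_dvd]
  exact ⟨-c (Fin.last d), by ring⟩

/-- The lattice of all `(aᵢ zᵢ)ᵢ` with `z ∈ ℤᵈ` and `∑ aᵢ zᵢ` divisible by the last entry. -/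
def frobeniusLattice (a : Fin (d + 1) → ℤ) : Submodule ℤ (Fin d → ℝ) :=
  (LinearMap.ker (residueMap a)).map (scaleMap a)

variable {a : Fin (d + 1) → ℤ}

theorem scaleMap_injective (ha : ∀ i, 0 < a i) : Function.Injective (scaleMap a) := by
  intro z w h
  funext i
  have h1 := congrFun h i
  have h2 : (a i.castSucc : ℝ) ≠ 0 := by exact_mod_cast (ha _).ne'
  simp only [scaleMap_apply] at h1
  exact_mod_cast mul_left_cancel₀ h2 h1

/-- The basis `(aᵢ eᵢ)ᵢ` of `ℝᵈ`. -/
noncomputable def scaleBasis (ha : ∀ i, 0 < a i) : Basis (Fin d) ℝ (Fin d → ℝ) :=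
  (Pi.basisFun ℝ (Fin d)).isUnitSMul (w := fun i => (a i.castSucc : ℝ))
    fun i => IsUnit.mk0 _ (by exact_mod_cast (ha _).ne')

theorem scaleBasis_apply (ha : ∀ i, 0 < a i) (i : Fin d) :
    scaleBasis ha i = scaleMap a (Pi.single i 1) := by
  ext j
  rw [scaleBasis, Basis.isUnitSMul_apply, scaleMap_apply]
  by_cases h : j = i
  · subst h; simp
  · simp [h]

theorem range_scaleMap (ha : ∀ i, 0 < a i) :
    LinearMap.range (scaleMap a) = Submodule.span ℤ (Set.range (scaleBasis ha)) := by
  have : Set.range (scaleBasis ha) = scaleMap a '' Set.range (Pi.basisFun ℤ (Fin d)) := by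
    rw [← Set.range_comp]
    congr 1
    funext i
    simp [scaleBasis_apply]
  rw [this, ← Submodule.map_span, Basis.span_eq, Submodule.map_top]

theorem covolume_span_scaleBasis (ha : ∀ i, 0 < a i) :
    ZLattice.covolume (Submodule.span ℤ (Set.range (scaleBasis ha))) =
      ∏ i : Fin d, (a i.castSucc : ℝ) := by
  rw [ZLattice.covolume_eq_det _ ((scaleBasis ha).restrictScalars ℤ)]
  have : Matrix.of ((↑) ∘ ((scaleBasis ha).restrictScalars ℤ)) =
      Matrix.diagonal fun i : Fin d => (a i.castSucc : ℝ) := by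
    ext i j
    simp only [Matrix.of_apply, Function.comp_apply, Basis.restrictScalars_apply,
      scaleBasis_apply, scaleMap_apply, Matrix.diagonal_apply]
    by_cases h : i = j
    · subst h; simp
    · simp [h, Ne.symm h]
  rw [this, Matrix.det_diagonal, abs_of_nonneg]
  exact prod_nonneg fun i _ => by exact_mod_cast (ha _).le

theorem frobeniusLattice_le (ha : ∀ i, 0 < a i) :
    frobeniusLattice a ≤ Submodule.span ℤ (Set.range (scaleBasis ha)) := by
  rw [← range_scaleMap]
  exact LinearMap.map_le_range

theorem discreteTopology_frobeniusLattice (ha : ∀ i, 0 < a i) :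
    DiscreteTopology (frobeniusLattice a) :=
  DiscreteTopology.of_subset (t := (frobeniusLattice a : Set (Fin d → ℝ)))
    (s := (Submodule.span ℤ (Set.range (scaleBasis ha)) : Set (Fin d → ℝ)))
    (inferInstanceAs (DiscreteTopology (Submodule.span ℤ (Set.range (scaleBasis ha)))))
    (frobeniusLattice_le ha)

theorem isZLattice_frobeniusLattice (ha : ∀ i, 0 < a i)
    [DiscreteTopology (frobeniusLattice a)] : IsZLattice ℝ (frobeniusLattice a) where
  span_top := by
    rw [eq_top_iff, ← (scaleBasis ha).span_eq, Submodule.span_le]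
    rintro _ ⟨i, rfl⟩
    have h0 : (a (Fin.last d) : ℝ) ≠ 0 := by exact_mod_cast (ha _).ne'
    -- The m-fold multiple of every vector aᵢeᵢ lies in the lattice, so it has full rank.
    have h1 : (a (Fin.last d) : ℝ) • scaleBasis ha i ∈
        Submodule.span ℝ (frobeniusLattice a : Set (Fin d → ℝ)) := by
      refine Submodule.subset_span ⟨a (Fin.last d) • Pi.single i 1, ?_, ?_⟩
      · rw [SetLike.mem_coe, mem_ker_residueMap]
        exact dvd_sum fun j _ => ⟨a j.castSucc * (Pi.single i 1 : Fin d → ℤ) j, by simp; ring⟩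
      · rw [map_smul, scaleBasis_apply, Int.cast_smul_eq_zsmul]
    have h2 := Submodule.smul_mem _ (a (Fin.last d) : ℝ)⁻¹ h1
    rwa [inv_smul_smul₀ h0] at h2

/-- Inside ⊕ aᵢℤ, of determinant a₁⋯a_d, the lattice is the kernel of a map to ℤ/m that is onto
because the gcd is 1; its index m supplies the missing factor. -/
theorem covolume_frobeniusLattice (ha : ∀ i, 0 < a i) (hg : univ.gcd a = 1)
    [DiscreteTopology (frobeniusLattice a)] [IsZLattice ℝ (frobeniusLattice a)] :
    ZLattice.covolume (frobeniusLattice a) = ∏ i, (a i : ℝ) := by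
  have h1 := ZLattice.covolume_div_covolume_eq_relIndex (frobeniusLattice a) _
    (frobeniusLattice_le ha)
  have h2 : (frobeniusLattice a).toAddSubgroup.relIndex
      (Submodule.span ℤ (Set.range (scaleBasis ha))).toAddSubgroup = (a (Fin.last d)).natAbs := by
    rw [← range_scaleMap, ← Submodule.map_top]
    change (AddSubgroup.map (scaleMap a).toAddMonoidHom
      (AddMonoidHom.ker (residueMap a).toAddMonoidHom)).relIndex
        (AddSubgroup.map (scaleMap a).toAddMonoidHom ⊤) = _
    rw [AddSubgroup.relIndex_map_map_of_injective _ _ (scaleMap_injective ha),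
      AddSubgroup.relIndex_top_right, AddSubgroup.index_ker,
      AddMonoidHom.range_eq_top.2 (residueMap_surjective hg)]
    simp
  have h3 : (0 : ℝ) < ∏ i : Fin d, (a i.castSucc : ℝ) :=
    prod_pos fun i _ => by exact_mod_cast ha _
  rw [h2, covolume_span_scaleBasis, div_eq_iff h3.ne'] at h1
  rw [h1, Fin.prod_univ_castSucc, mul_comm]
  congr 1
  have : (((a (Fin.last d)).natAbs : ℤ) : ℝ) = a (Fin.last d) := by
    rw [Int.natAbs_of_nonneg (ha _).le]
  rwa [Int.cast_natCast] at this

theorem absInhomogeneousMinimum_mul_le (hd : 1 ≤ d) (hs : 1 ≤ s) (ha : ∀ i, 0 < a i)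
    (hg : univ.gcd a = 1) :
    absInhomogeneousMinimum s (standardSimplex d) * (∏ i, (a i : ℝ)) ^ (1 / (d : ℝ)) ≤
      frobeniusNumber s a + ∑ i, (a i : ℝ) := by
  have := discreteTopology_frobeniusLattice ha
  have := isZLattice_frobeniusLattice ha
  have hP : (0 : ℝ) < ∏ i, (a i : ℝ) := prod_pos fun i _ => by exact_mod_cast ha _
  have hF := isGreatest_frobeniusNumber hd hs ha hg
  have hμ : (0 : ℝ) < frobeniusNumber s a + ∑ i, (a i : ℝ) := by
    -- Positivity of the candidate radius: F ≥ -1 since -1 is deficient, while ∑ aᵢ ≥ d + 1.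
    have h2 : -1 ≤ frobeniusNumber s a := hF.2 (neg_mem_deficientSet ha hs (by norm_num))
    have h3 : ∑ i : Fin (d + 1), (1 : ℤ) ≤ ∑ i, a i := sum_le_sum fun i _ => ha i
    simp only [sum_const, card_univ, Fintype.card_fin, nsmul_eq_mul, mul_one] at h3
    have h4 : 0 < frobeniusNumber s a + ∑ i, a i := by push_cast at h3; omega
    exact_mod_cast h4
  have h1 := absInhomogeneousMinimum_le (s := s) (K := standardSimplex d) (frobeniusLattice a)
  rw [covolume_frobeniusLattice ha hg, le_div_iff₀ (Real.rpow_pos_of_pos hP _)] at h1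
  refine h1.trans (coveringRadius_le hμ fun x => ?_)
  · have ha' : ∀ i : Fin d, (0 : ℝ) < a i.castSucc := fun i => by exact_mod_cast ha _
    obtain ⟨y, hinj, hy⟩ := covering_of_isGreatest ha hF fun i => x i / a i.castSucc
    refine ⟨fun k => scaleMap a (y k), (scaleMap_injective ha).comp hinj,
      fun k => ⟨y k, mem_ker_residueMap.2 (hy k).1, rfl⟩, fun k => ?_⟩
    rw [mem_smul_standardSimplex hμ]
    refine ⟨fun i => ?_, ?_⟩
    · change scaleMap a (y k) i ≤ x i
      rw [scaleMap_apply, mul_comm, ← le_div_iff₀ (ha' i)]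
      exact (hy k).2.1 i
    · refine le_trans (le_of_eq (sum_congr rfl fun i _ => ?_)) (hy k).2.2
      change x i - scaleMap a (y k) i = _
      rw [scaleMap_apply, mul_sub, mul_div_cancel₀ _ (ha' i).ne']

end Knapsack

/-! ### Signed minors and approximation by primitive integer matrices. -/

namespace Knapsack

open Finset Module Filter Topology
open scoped Matrix

/-- The vector of signed maximal minors of a `d × (d + 1)` matrix. -/
def signedMinors {d : ℕ} {R : Type*} [CommRing R] (v : Matrix (Fin d) (Fin (d + 1)) R) :
    Fin (d + 1) → R :=
  fun j => (-1) ^ (j : ℕ) * (v.submatrix id j.succAbove).det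

section

variable {d : ℕ} {R : Type*} [CommRing R]

/-- Laplace expansion along the added row. It yields both orthogonality to the rows (a repeated row)
and the coprimality certificate (an added row making the determinant a unit). -/
theorem dotProduct_signedMinors (w : Fin (d + 1) → R) (v : Matrix (Fin d) (Fin (d + 1)) R) :
    w ⬝ᵥ signedMinors v = (Matrix.of (Fin.cons w v : Fin (d + 1) → Fin (d + 1) → R)).det := by
  rw [Matrix.det_succ_row_zero]
  refine sum_congr rfl fun j _ => ?_
  simp only [signedMinors, Matrix.of_apply]
  rw [mul_left_comm, mul_assoc]
  rfl

theorem row_dotProduct_signedMinors (v : Matrix (Fin d) (Fin (d + 1)) R) (i : Fin d) :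
    v i ⬝ᵥ signedMinors v = 0 := by
  rw [dotProduct_signedMinors]
  exact Matrix.det_zero_of_row_eq (Fin.succ_ne_zero i).symm rfl

theorem signedMinors_mul (P : Matrix (Fin d) (Fin d) R) (v : Matrix (Fin d) (Fin (d + 1)) R) :
    signedMinors (P * v) = P.det • signedMinors v := by
  ext j
  have : (P * v).submatrix id j.succAbove = P * v.submatrix id j.succAbove := by
    ext; simp [Matrix.mul_apply]
  simp only [signedMinors, this, Matrix.det_mul, Pi.smul_apply, smul_eq_mul]
  ring

theorem signedMinors_smul (c : R) (v : Matrix (Fin d) (Fin (d + 1)) R) :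
    signedMinors (c • v) = c ^ d • signedMinors v := by
  ext j
  simp only [signedMinors, Matrix.submatrix_smul, Pi.smul_apply, Matrix.det_smul,
    Fintype.card_fin, smul_eq_mul]
  ring

theorem signedMinors_map {S : Type*} [CommRing S] (f : R →+* S)
    (v : Matrix (Fin d) (Fin (d + 1)) R) (j : Fin (d + 1)) :
    signedMinors (v.map f) j = f (signedMinors v j) := by
  simp only [signedMinors, map_mul, map_pow, map_neg, map_one, RingHom.map_det]
  rfl

theorem signedMinors_last (v : Matrix (Fin d) (Fin (d + 1)) R) :
    signedMinors v (Fin.last d) = (-1) ^ d * (v.submatrix id Fin.castSucc).det := by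
  simp [signedMinors, Fin.succAbove_last]

theorem continuous_signedMinors :
    Continuous (signedMinors : Matrix (Fin d) (Fin (d + 1)) ℝ → Fin (d + 1) → ℝ) :=
  continuous_pi fun _ => continuous_const.mul
    (Continuous.matrix_det (continuous_id.matrix_submatrix _ _))

theorem linearIndependent_of_signedMinors_ne_zero [IsDomain R] {v : Matrix (Fin d) (Fin (d + 1)) R}
    {j : Fin (d + 1)} (h : signedMinors v j ≠ 0) : LinearIndependent R (fun i => v i) := by
  have h1 : (v.submatrix id j.succAbove).det ≠ 0 := right_ne_zero_of_mul h
  have h2 := Matrix.linearIndependent_rows_of_det_ne_zero h1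
  exact LinearIndependent.of_comp (LinearMap.funLeft R R j.succAbove) h2

end

/-- The row lattice of `c N + E` is primitive for a suitable `E` independent of `c`. -/
theorem exists_isUnit_dotProduct_signedMinors {d : ℕ} {N : Matrix (Fin d) (Fin (d + 1)) ℤ}
    (hN : LinearIndependent ℤ (fun i => N i)) :
    ∃ (E : Matrix (Fin d) (Fin (d + 1)) ℤ) (w : Fin (d + 1) → ℤ),
      ∀ c : ℤ, IsUnit (w ⬝ᵥ signedMinors (c • N + E)) := by
  let B := Basis.span hN
  -- The row lattice has a basis of multiples of vectors from a basis of ℤᵈ⁺¹. The one ambient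
  -- vector left over is moved to the last position.
  obtain ⟨n, S⟩ := Submodule.smithNormalForm (Pi.basisFun ℤ (Fin (d + 1)))
    (Submodule.span ℤ (Set.range fun i => N i))
  obtain rfl : n = d := Fin.equiv_iff_eq.1 ⟨S.bN.indexEquiv B⟩
  obtain ⟨g, hg⟩ : ∃ g, g ∉ Set.range S.f := by
    by_contra h
    push Not at h
    have := Fintype.card_le_of_surjective S.f h
    simp at this
  let e : Fin (n + 1) ≃ Fin (n + 1) := Equiv.ofBijective (Fin.snoc (α := fun _ => _) S.f g)
    (Finite.injective_iff_bijective.1 (Fin.snoc_injective_iff.2 ⟨S.f.injective, hg⟩))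
  let b := S.bM.reindex e.symm
  have hb : ∀ i : Fin n, (S.bN i : Fin (n + 1) → ℤ) = S.a i • b i.castSucc := fun i => by
    rw [S.snf, Basis.reindex_apply]
    simp [e]
  let M : Matrix (Fin (n + 1)) (Fin (n + 1)) ℤ := Matrix.of fun i => b i
  have hM : IsUnit M.det := by
    have := (Pi.basisFun ℤ (Fin (n + 1))).isUnit_det b
    rwa [Pi.basisFun_det] at this
  let P : Matrix (Fin n) (Fin n) ℤ := (S.bN.toMatrix B).transpose
  have hP : IsUnit P.det := by
    rw [Matrix.det_transpose, ← Basis.det_apply]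
    exact S.bN.isUnit_det B
  have hPN : N = P * Matrix.of fun k => (S.bN k : Fin (n + 1) → ℤ) := by
    ext i j
    have h1 : ∑ k, S.bN.toMatrix B k i • S.bN k = B i := S.bN.sum_toMatrix_smul_self B i
    have h2 := congrFun (congrArg Subtype.val h1) j
    have h3 : ((B i : _) : Fin (n + 1) → ℤ) = N i := congrArg Subtype.val (Basis.span_apply hN i)
    rw [h3] at h2
    rw [← h2]
    simp [Matrix.mul_apply, P, -Basis.sum_toMatrix_smul_self]
  -- Up to the unimodular `P`, row k of c N + E is c·aₖ·bₖ + bₖ₊₁. Adding b₀ as first row gives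
  -- coefficients in the basis b forming a lower bidiagonal matrix with unit diagonal, whatever c
  -- is.
  refine ⟨P * Matrix.of fun k => b k.succ, b 0, fun c => ?_⟩
  have hcomb : c • N + P * Matrix.of (fun k => b k.succ) =
      P * Matrix.of fun k => (c * S.a k) • b k.castSucc + b k.succ := by
    have hdist : ∀ Q Q' : Matrix (Fin n) (Fin (n + 1)) ℤ,
        c • (P * Q) + P * Q' = P * (c • Q + Q') := fun Q Q' => by
      rw [Matrix.mul_add, Matrix.mul_smul]
    refine (congrArg (c • · + _) hPN).trans ((hdist _ _).trans (congrArg (P * ·) ?_))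
    ext k j
    simp [hb, mul_assoc]
  rw [hcomb, signedMinors_mul, dotProduct_smul, smul_eq_mul]
  refine hP.mul ?_
  rw [dotProduct_signedMinors]
  let C : Matrix (Fin (n + 1)) (Fin (n + 1)) ℤ :=
    Matrix.of (Fin.cons (Pi.single 0 1) fun k =>
      (c * S.a k) • Pi.single k.castSucc 1 + Pi.single k.succ 1)
  have hC : C.det = 1 := by
    rw [Matrix.det_of_isLowerTriangular]
    · refine prod_eq_one fun i _ => ?_
      refine Fin.cases ?_ (fun k => ?_) i
      · simp [C]
      · simp [C, Fin.castSucc_lt_succ.ne']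
    · intro i j hij
      have hij' : i < j := hij
      revert hij'
      refine Fin.cases ?_ (fun k => ?_) i
      · intro h
        simp [C, h.ne']
      · intro h
        have h1 : k.castSucc < j := Fin.castSucc_lt_succ.trans h
        simp [C, h.ne', h1.ne']
  have hCM : Matrix.of (Fin.cons (b 0)
      (Matrix.of fun k => (c * S.a k) • b k.castSucc + b k.succ) :
        Fin (n + 1) → Fin (n + 1) → ℤ) = C * M := by
    funext i
    rw [Matrix.mul_apply_eq_vecMul]
    refine Fin.cases ?_ (fun k => ?_) i
    · change b 0 = (Pi.single 0 1) ᵥ* M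
      rw [Matrix.single_one_vecMul]
      rfl
    · change (c * S.a k) • b k.castSucc + b k.succ =
        ((c * S.a k) • Pi.single k.castSucc 1 + Pi.single k.succ 1) ᵥ* M
      rw [Matrix.add_vecMul, Matrix.smul_vecMul, Matrix.single_one_vecMul,
        Matrix.single_one_vecMul]
      rfl
  rw [hCM, Matrix.det_mul, hC, one_mul]
  exact hM

/-- Every real matrix with nonzero last minor is a limit of rescaled integer matrices with
coprime maximal minors. -/
theorem exists_primitive_approximation {d : ℕ} {N : Matrix (Fin d) (Fin (d + 1)) ℝ}
    (hN : signedMinors N (Fin.last d) ≠ 0) {p : Matrix (Fin d) (Fin (d + 1)) ℝ → Prop}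
    (hp : ∀ᶠ X in 𝓝 N, p X) :
    ∃ (t : ℝ) (v : Matrix (Fin d) (Fin (d + 1)) ℤ) (w : Fin (d + 1) → ℤ), 0 < t ∧
      IsUnit (w ⬝ᵥ signedMinors v) ∧ p (t⁻¹ • v.map (Int.castRingHom ℝ)) := by
  have h0 : ∀ᶠ X in 𝓝 N, signedMinors X (Fin.last d) ≠ 0 :=
    ((continuous_apply _).comp continuous_signedMinors).continuousAt.eventually_ne hN
  have hlim : Tendsto (fun q : ℝ => q⁻¹ • (Matrix.of fun i j => ⌊q * N i j⌋).map
      (Int.castRingHom ℝ)) atTop (𝓝 N) := by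
    refine tendsto_pi_nhds.2 fun i => tendsto_pi_nhds.2 fun j => ?_
    have h1 : Tendsto (fun q : ℝ => N i j - q⁻¹) atTop (𝓝 (N i j)) := by
      simpa using tendsto_const_nhds.sub (tendsto_inv_atTop_zero (𝕜 := ℝ))
    refine tendsto_of_tendsto_of_tendsto_of_le_of_le' h1 tendsto_const_nhds ?_ ?_
    · filter_upwards [eventually_gt_atTop 0] with q hq
      have := Int.sub_one_lt_floor (q * N i j)
      simp only [Matrix.smul_apply, Matrix.map_apply, Matrix.of_apply, smul_eq_mul,
        Int.coe_castRingHom]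
      rw [← div_eq_inv_mul, le_div_iff₀ hq, sub_mul, inv_mul_cancel₀ hq.ne']
      linarith
    · filter_upwards [eventually_gt_atTop 0] with q hq
      have := Int.floor_le (q * N i j)
      simp only [Matrix.smul_apply, Matrix.map_apply, Matrix.of_apply, smul_eq_mul,
        Int.coe_castRingHom]
      rw [← div_eq_inv_mul, div_le_iff₀ hq]
      linarith
  -- First approximation: a rescaled integer matrix. `eventually_nhds` keeps p valid in a
  -- neighbourhood of it, leaving room for the correction by E.
  obtain ⟨q, hq0, hq1, hq2⟩ := ((eventually_gt_atTop 0).and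
    (hlim.eventually (hp.eventually_nhds.and h0))).exists
  set N₀ : Matrix (Fin d) (Fin (d + 1)) ℤ := Matrix.of fun i j => ⌊q * N i j⌋
  have hind : LinearIndependent ℤ (fun i => N₀ i) := by
    refine linearIndependent_of_signedMinors_ne_zero (j := Fin.last d) fun h => hq2 ?_
    rw [signedMinors_smul, Pi.smul_apply, signedMinors_map, h]
    simp
  obtain ⟨E, w, hE⟩ := exists_isUnit_dotProduct_signedMinors hind
  -- As E does not depend on c, its contribution vanishes after division by qc.
  have hlim2 : Tendsto (fun c : ℕ => (q * c)⁻¹ • (((c : ℤ) • N₀ + E).map (Int.castRingHom ℝ)))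
      atTop (𝓝 (q⁻¹ • N₀.map (Int.castRingHom ℝ))) := by
    have h1 : Tendsto (fun c : ℕ => q⁻¹ • N₀.map (Int.castRingHom ℝ) +
        ((c : ℝ)⁻¹ * q⁻¹) • E.map (Int.castRingHom ℝ)) atTop
        (𝓝 (q⁻¹ • N₀.map (Int.castRingHom ℝ) + ((0 : ℝ) * q⁻¹) • E.map (Int.castRingHom ℝ))) :=
      tendsto_const_nhds.add
        ((tendsto_inv_atTop_nhds_zero_nat.mul_const _).smul_const _)
    rw [zero_mul, zero_smul, add_zero] at h1
    refine h1.congr' ?_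
    filter_upwards [eventually_gt_atTop 0] with c hc
    have hc' : (c : ℝ) ≠ 0 := by exact_mod_cast hc.ne'
    ext i j
    simp
    field_simp
  obtain ⟨c, hc0, hc1⟩ := ((eventually_gt_atTop 0).and (hlim2.eventually hq1)).exists
  exact ⟨q * c, _, w, mul_pos hq0 (by exact_mod_cast hc0), hE c, hc1⟩

end Knapsack

/-! ### Coverings along a lattice basis and their stability. -/

namespace Knapsack

open Finset Module Filter Topology
open scoped Matrix

variable {d s : ℕ}

/-- The translates of `μ` times the standard simplex along the integer combinations of the rows
of `b` cover every point at least `s` times. -/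
def Covers (s : ℕ) (b : Matrix (Fin d) (Fin d) ℝ) (μ : ℝ) : Prop :=
  ∀ x : Fin d → ℝ, ∃ n : Fin s → Fin d → ℤ, Function.Injective n ∧
    ∀ k, (∀ j, ((fun i => (n k i : ℝ)) ᵥ* b) j ≤ x j) ∧
      ∑ j, (x j - ((fun i => (n k i : ℝ)) ᵥ* b) j) ≤ μ

/-- Makes the set defining the covering radius nonempty, without which `sInf` would be the default
0. Shift x down by C in every coordinate, round its coefficients down and add k times the first row:
each coordinate errs by at most C = (s + 1)R, so all differences lie in [0, 2C]. -/
theorem exists_covers (hd : 1 ≤ d) {b : Matrix (Fin d) (Fin d) ℝ} (hb : b.det ≠ 0) :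
    ∃ μ, 0 < μ ∧ Covers s b μ := by
  set R : ℝ := ∑ i, ∑ j, |b i j| with hR
  have hR0 : 0 ≤ R := sum_nonneg fun i _ => sum_nonneg fun j _ => abs_nonneg _
  have hbR : ∀ i j, |b i j| ≤ R := fun i j =>
    (single_le_sum (f := fun j => |b i j|) (fun j _ => abs_nonneg _) (mem_univ j)).trans
      (single_le_sum (f := fun i => ∑ j, |b i j|)
        (fun i _ => sum_nonneg fun j _ => abs_nonneg _) (mem_univ i))
  refine ⟨d * (2 * ((s + 1) * R)) + 1, by positivity, fun x => ?_⟩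
  set C : ℝ := (s + 1) * R with hC
  set c : Fin d → ℝ := (fun j => x j - C) ᵥ* b⁻¹ with hc
  have hcb : c ᵥ* b = fun j => x j - C := by
    rw [hc, Matrix.vecMul_vecMul, Matrix.nonsing_inv_mul _ (isUnit_iff_ne_zero.2 hb),
      Matrix.vecMul_one]
  let n : Fin s → Fin d → ℤ := fun k i => ⌊c i⌋ + (k : ℕ) * (Pi.single ⟨0, hd⟩ 1 : Fin d → ℤ) i
  have hn : ∀ k, (fun i => (n k i : ℝ)) = c - (fun i => Int.fract (c i)) +
      ((k : ℕ) : ℝ) • Pi.single ⟨0, hd⟩ 1 := fun k => by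
    funext i
    simp only [n, Pi.add_apply, Pi.sub_apply, Int.self_sub_fract, Pi.smul_apply, smul_eq_mul]
    by_cases h : i = ⟨0, hd⟩
    · subst h; simp
    · simp [h]
  have hdiff : ∀ k j, x j - ((fun i => (n k i : ℝ)) ᵥ* b) j =
      C + (((fun i => Int.fract (c i)) ᵥ* b) j - k * b ⟨0, hd⟩ j) := fun k j => by
    rw [hn, Matrix.add_vecMul, Matrix.sub_vecMul, hcb, Matrix.smul_vecMul,
      Matrix.single_one_vecMul]
    simp only [Pi.add_apply, Pi.sub_apply, Pi.smul_apply, smul_eq_mul, Matrix.row]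
    ring
  have hsmall : ∀ (k : Fin s) j,
      |((fun i => Int.fract (c i)) ᵥ* b) j - k * b ⟨0, hd⟩ j| ≤ C := fun k j => by
    rw [sub_eq_add_neg]
    refine (abs_add_le _ _).trans ?_
    rw [abs_neg]
    have h1 : |((fun i => Int.fract (c i)) ᵥ* b) j| ≤ R := by
      simp only [Matrix.vecMul, dotProduct]
      refine (abs_sum_le_sum_abs _ _).trans (sum_le_sum fun i _ => ?_)
      rw [abs_mul, abs_of_nonneg (Int.fract_nonneg _)]
      refine (mul_le_of_le_one_left (abs_nonneg _) (Int.fract_lt_one _).le).trans ?_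
      exact single_le_sum (f := fun j => |b i j|) (fun j _ => abs_nonneg _) (mem_univ j)
    have h2 : |(k : ℝ) * b ⟨0, hd⟩ j| ≤ s * R := by
      rw [abs_mul, abs_of_nonneg (Nat.cast_nonneg _)]
      exact mul_le_mul (by exact_mod_cast k.2.le) (hbR _ _) (abs_nonneg _) (Nat.cast_nonneg _)
    rw [hC]
    linarith
  refine ⟨n, fun k l hkl => ?_, fun k => ⟨fun j => ?_, ?_⟩⟩
  · have := congrFun hkl ⟨0, hd⟩
    simp only [n, Pi.single_eq_same, mul_one, add_right_inj] at this
    exact Fin.ext (by exact_mod_cast this)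
  · have h1 := hdiff k j
    have h2 := neg_le_of_abs_le (hsmall k j)
    linarith
  · calc ∑ j, (x j - ((fun i => (n k i : ℝ)) ᵥ* b) j) ≤ ∑ _j : Fin d, 2 * C :=
          sum_le_sum fun j _ => by
            have h1 := hdiff k j
            have h2 := le_of_abs_le (hsmall k j)
            linarith
      _ ≤ _ := by simp

/-- Write b' = bT with T near 1 and pull x back by T⁻¹. Applying T to a point κ of the μ-simplex
moves each coordinate by at most ημ; shifting x by ημ beforehand restores nonnegativity, and the sum
grows by at most 2dημ. -/
theorem Covers.eventually {b : Matrix (Fin d) (Fin d) ℝ} (hb : b.det ≠ 0) {μ μ' : ℝ}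
    (h : Covers s b μ) (hμ : 0 < μ) (hμ' : μ < μ') : ∀ᶠ b' in 𝓝 b, Covers s b' μ' := by
  have hb' : IsUnit b.det := isUnit_iff_ne_zero.2 hb
  obtain ⟨η, hη0, hη⟩ : ∃ η : ℝ, 0 < η ∧ μ + d * (2 * (η * μ)) ≤ μ' := by
    refine ⟨(μ' - μ) / (2 * μ * (d + 1)), div_pos (by linarith) (by positivity), ?_⟩
    have : d * (2 * ((μ' - μ) / (2 * μ * (d + 1)) * μ)) = (μ' - μ) * (d / (d + 1)) := by
      field_simp
    rw [this]
    have h1 : (d : ℝ) / (d + 1) ≤ 1 := (div_le_one (by positivity)).2 (by linarith)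
    nlinarith
  have hcont : Continuous fun b' : Matrix (Fin d) (Fin d) ℝ => b⁻¹ * b' :=
    continuous_const.matrix_mul continuous_id
  have h1 : b⁻¹ * b = 1 := Matrix.nonsing_inv_mul _ hb'
  have hdet : ∀ᶠ b' in 𝓝 b, (b⁻¹ * b').det ≠ 0 :=
    (Continuous.matrix_det hcont).continuousAt.eventually_ne (by simp [h1])
  have hnear : ∀ᶠ b' in 𝓝 b, ∀ i j, |(b⁻¹ * b' - 1) i j| < η := by
    refine eventually_all.2 fun i => eventually_all.2 fun j => ?_
    have hc : Continuous fun b' : Matrix (Fin d) (Fin d) ℝ => |(b⁻¹ * b' - 1) i j| :=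
      (((hcont.sub continuous_const).matrix_elem i j)).abs
    refine hc.continuousAt.eventually_lt continuousAt_const ?_
    simpa [h1] using hη0
  filter_upwards [hdet, hnear] with b' hdet hnear x
  set T := b⁻¹ * b' with hT
  have hbT : b * T = b' := by
    rw [hT, ← mul_assoc, Matrix.mul_nonsing_inv _ hb', one_mul]
  obtain ⟨n, hinj, hn⟩ := h ((fun j => x j - η * μ) ᵥ* T⁻¹)
  refine ⟨n, hinj, fun k => ?_⟩
  obtain ⟨hn0, hn1⟩ := hn k
  set κ : Fin d → ℝ := ((fun j => x j - η * μ) ᵥ* T⁻¹) - (fun i => (n k i : ℝ)) ᵥ* b with hκ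
  have hκ0 : ∀ j, 0 ≤ κ j := fun j => sub_nonneg.2 (hn0 j)
  have hκ1 : ∑ j, κ j ≤ μ := hn1
  have hκT : κ ᵥ* T = (fun j => x j - η * μ) - (fun i => (n k i : ℝ)) ᵥ* b' := by
    rw [hκ, Matrix.sub_vecMul, Matrix.vecMul_vecMul, Matrix.vecMul_vecMul,
      Matrix.nonsing_inv_mul _ (isUnit_iff_ne_zero.2 hdet), Matrix.vecMul_one, hbT]
  have hdiff : ∀ j, x j - ((fun i => (n k i : ℝ)) ᵥ* b') j =
      κ j + (η * μ + (κ ᵥ* (T - 1)) j) := fun j => by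
    have h2 := congrFun hκT j
    rw [Matrix.vecMul_sub, Matrix.vecMul_one]
    simp only [Pi.sub_apply] at h2 ⊢
    linarith
  have hsmall : ∀ j, |(κ ᵥ* (T - 1)) j| ≤ η * μ := fun j => by
    calc |(κ ᵥ* (T - 1)) j| ≤ ∑ i, |κ i * (T - 1) i j| := by
          simp only [Matrix.vecMul, dotProduct]
          exact abs_sum_le_sum_abs _ _
      _ ≤ ∑ i, η * κ i := sum_le_sum fun i _ => by
          rw [abs_mul, abs_of_nonneg (hκ0 i), mul_comm]
          exact mul_le_mul_of_nonneg_right (hnear i j).le (hκ0 i)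
      _ ≤ η * μ := by
          rw [← mul_sum]
          exact mul_le_mul_of_nonneg_left hκ1 hη0.le
  refine ⟨fun j => ?_, ?_⟩
  · have h2 := hdiff j
    have h3 := neg_le_of_abs_le (hsmall j)
    have h4 := hκ0 j
    linarith
  · calc ∑ j, (x j - ((fun i => (n k i : ℝ)) ᵥ* b') j) ≤ ∑ j, (κ j + 2 * (η * μ)) :=
          sum_le_sum fun j _ => by
            have h2 := hdiff j
            have h3 := le_of_abs_le (hsmall j)
            linarith
      _ = ∑ j, κ j + d * (2 * (η * μ)) := by simp [sum_add_distrib]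
      _ ≤ μ' := by linarith

section Lattice

variable {L : Submodule ℤ (Fin d → ℝ)} [DiscreteTopology L] [IsZLattice ℝ L]

theorem exists_covers_of_coveringRadius_lt (hd : 1 ≤ d) (B : Basis (Fin d) ℤ L) {r : ℝ}
    (hr : coveringRadius s (standardSimplex d) L < r) :
    ∃ μ, 0 < μ ∧ μ < r ∧ Covers s (Matrix.of fun i => (B i : Fin d → ℝ)) μ := by
  set b : Matrix (Fin d) (Fin d) ℝ := Matrix.of fun i => (B i : Fin d → ℝ) with hb
  have hdet : b.det ≠ 0 := by
    have := (ZLattice.covolume_pos L).ne'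
    rw [ZLattice.covolume_eq_det L B] at this
    exact abs_ne_zero.1 this
  have hcomb : ∀ n : Fin d → ℤ, (fun i => (n i : ℝ)) ᵥ* b = ((∑ i, n i • B i : L) : Fin d → ℝ) := by
    intro n
    ext j
    simp [Matrix.vecMul, dotProduct, hb]
  have hbinj : Function.Injective fun n : Fin d → ℤ => ∑ i, n i • B i := fun n n' h => by
    have h1 := congrArg B.repr h
    funext i
    have h2 := DFunLike.congr_fun h1 i
    simpa [Finsupp.single_apply] using h2
  have hspan : Submodule.span ℝ (L : Set (Fin d → ℝ)) = ⊤ := IsZLattice.span_top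
  obtain ⟨μ, ⟨hμ0, hμ⟩, hμr⟩ := exists_lt_of_csInf_lt (by
    obtain ⟨μ, hμ, hcov⟩ := exists_covers (s := s) hd hdet
    refine ⟨μ, hμ, fun x _ => ?_⟩
    obtain ⟨n, hn, hcov⟩ := hcov x
    refine ⟨fun k => ((∑ i, n k i • B i : L) : Fin d → ℝ),
      Subtype.val_injective.comp (hbinj.comp hn), fun k => Subtype.property _, fun k => ?_⟩
    rw [mem_smul_standardSimplex hμ]
    have := hcov k
    rwa [hcomb] at this) hr
  refine ⟨μ, hμ0, hμr, fun x => ?_⟩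
  obtain ⟨y, hinj, hyL, hy⟩ := hμ x (by rw [hspan]; trivial)
  have hrep : ∀ k, (fun i => (B.repr ⟨y k, hyL k⟩ i : ℝ)) ᵥ* b = y k := fun k => by
    rw [hcomb, B.sum_repr]
  refine ⟨fun k i => B.repr ⟨y k, hyL k⟩ i, fun k l hkl => hinj ?_, fun k => ?_⟩
  · rw [← hrep k, ← hrep l]
    congr 1
    funext i
    exact congrArg _ (congrFun hkl i)
  · have := (mem_smul_standardSimplex hμ0).1 (hy k)
    rw [← hrep k] at this
    exact this

end Lattice

/-- A covering along an integral sublattice of the Frobenius lattice bounds the Frobenius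
number. -/
theorem Covers.frobeniusNumber_add_sum_le (hd : 1 ≤ d) (hs : 1 ≤ s) {a : Fin (d + 1) → ℤ}
    (ha : ∀ i, 0 < a i) (hg : univ.gcd a = 1) {v : Matrix (Fin d) (Fin (d + 1)) ℤ}
    (hv : ∀ i, v i ⬝ᵥ a = 0) (hdet : (v.submatrix id Fin.castSucc).det ≠ 0) {c μ : ℝ} (hc : 0 < c)
    (h : Covers s (Matrix.of fun i (j : Fin d) => c⁻¹ * (a j.castSucc * v i j.castSucc)) μ) :
    frobeniusNumber s a + ∑ i, (a i : ℝ) ≤ c * μ := by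
  refine add_sum_le_of_covering ha hg (fun x => ?_) (isGreatest_frobeniusNumber hd hs ha hg).1
  obtain ⟨n, hinj, hn⟩ := h fun j => c⁻¹ * (a j.castSucc * x j)
  have ha' : ∀ j : Fin d, (0 : ℝ) < a j.castSucc := fun i => by exact_mod_cast ha _
  let y : Fin s → Fin d → ℤ := fun k => n k ᵥ* v.submatrix id Fin.castSucc
  have hy : ∀ k j, ((fun i => (n k i : ℝ)) ᵥ* Matrix.of fun i (j : Fin d) =>
      c⁻¹ * ((a j.castSucc : ℝ) * v i j.castSucc)) j = c⁻¹ * (a j.castSucc * y k j) := by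
    intro k j
    simp only [y, Matrix.vecMul, dotProduct, Matrix.of_apply, Matrix.submatrix_apply, id]
    push_cast
    rw [mul_sum, mul_sum]
    exact sum_congr rfl fun i _ => by ring
  refine ⟨y, fun k l hkl => hinj ?_, fun k => ⟨?_, fun j => ?_, ?_⟩⟩
  · refine sub_eq_zero.1 (Matrix.eq_zero_of_vecMul_eq_zero hdet ?_)
    rw [Matrix.sub_vecMul]
    exact sub_eq_zero.2 hkl
  -- Orthogonality of the rows of `v` to `a` is what puts their truncations into the lattice Λ.
  · have h1 : ∑ j : Fin d, a j.castSucc * y k j =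
        -(a (Fin.last d) * ∑ i, n k i * v i (Fin.last d)) := by
      have h2 : ∀ i, ∑ j : Fin d, v i j.castSucc * a j.castSucc =
          -(v i (Fin.last d) * a (Fin.last d)) := fun i => by
        have := hv i
        rw [dotProduct, Fin.sum_univ_castSucc] at this
        linarith
      calc ∑ j : Fin d, a j.castSucc * y k j
          = ∑ j : Fin d, ∑ i, n k i * (v i j.castSucc * a j.castSucc) := by
            refine sum_congr rfl fun j _ => ?_
            simp only [y, Matrix.vecMul, dotProduct, Matrix.submatrix_apply, id]
            rw [mul_sum]
            exact sum_congr rfl fun i _ => by ring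
        _ = _ := by
            rw [sum_comm, mul_sum, ← sum_neg_distrib]
            refine sum_congr rfl fun i _ => ?_
            rw [← mul_sum, h2]
            ring
    rw [h1]
    exact (Dvd.intro _ rfl).neg_right
  · have h1 := (hn k).1 j
    rw [hy] at h1
    exact le_of_mul_le_mul_left (le_of_mul_le_mul_left h1 (inv_pos.2 hc)) (ha' j)
  · have h1 := (hn k).2
    simp only [hy, ← mul_sub, ← mul_sum] at h1
    rwa [inv_mul_le_iff₀ hc] at h1

end Knapsack

/-! ### Construction of vectors with prescribed ratios and small Frobenius number. -/

namespace Knapsack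

open Finset Module Filter Topology
open scoped Matrix

variable {d s : ℕ}

/-- The rows of `b diag(α)⁻¹`, extended by a last entry making them orthogonal to `(α, 1)`. -/
noncomputable def slopeMatrix (b : Matrix (Fin d) (Fin d) ℝ) (α : Fin d → ℝ) :
    Matrix (Fin d) (Fin (d + 1)) ℝ :=
  Matrix.of fun i => Fin.snoc (α := fun _ => ℝ) (fun j => b i j * (α j)⁻¹) (-∑ j, b i j)

theorem slopeMatrix_submatrix (b : Matrix (Fin d) (Fin d) ℝ) (α : Fin d → ℝ) :
    (slopeMatrix b α).submatrix id Fin.castSucc = b * Matrix.diagonal fun j => (α j)⁻¹ := by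
  ext i j
  simp [slopeMatrix]

theorem abs_signedMinors_slopeMatrix_last {b : Matrix (Fin d) (Fin d) ℝ} {α : Fin d → ℝ}
    (hα : ∀ j, 0 < α j) :
    (∏ j, α j) * |signedMinors (slopeMatrix b α) (Fin.last d)| = |b.det| := by
  have h : 0 < ∏ j, α j := prod_pos fun j _ => hα j
  rw [signedMinors_last, slopeMatrix_submatrix, Matrix.det_mul, Matrix.det_diagonal, abs_mul,
    abs_mul, abs_pow, abs_neg, abs_one, one_pow, one_mul, prod_inv_distrib, abs_inv,
    abs_of_pos h]
  field_simp

/-- Both (α, 1) and the vector of minors are orthogonal to all rows, and the orthogonal complement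
is a line because the first d columns are invertible. -/
theorem signedMinors_slopeMatrix_castSucc {b : Matrix (Fin d) (Fin d) ℝ} (hb : b.det ≠ 0)
    {α : Fin d → ℝ} (hα : ∀ j, 0 < α j) (j : Fin d) :
    signedMinors (slopeMatrix b α) j.castSucc =
      α j * signedMinors (slopeMatrix b α) (Fin.last d) := by
  set φ := signedMinors (slopeMatrix b α) with hφ
  have hdet : ((slopeMatrix b α).submatrix id Fin.castSucc).det ≠ 0 := by
    rw [slopeMatrix_submatrix, Matrix.det_mul, Matrix.det_diagonal]
    exact mul_ne_zero hb (prod_ne_zero_iff.2 fun j _ => inv_ne_zero (hα j).ne')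
  have h := Matrix.eq_zero_of_mulVec_eq_zero hdet
    (v := fun j => φ j.castSucc - α j * φ (Fin.last d)) ?_
  · exact sub_eq_zero.1 (congrFun h j)
  · funext i
    have h1 := row_dotProduct_signedMinors (slopeMatrix b α) i
    rw [dotProduct, Fin.sum_univ_castSucc] at h1
    have h2 : slopeMatrix b α i (Fin.last d) = -∑ j, b i j := by simp [slopeMatrix]
    have h3 : ∑ j : Fin d, slopeMatrix b α i j.castSucc * (α j * φ (Fin.last d)) =
        (∑ j, b i j) * φ (Fin.last d) := by
      rw [sum_mul]
      refine sum_congr rfl fun j _ => ?_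
      have := (hα j).ne'
      simp only [slopeMatrix, Matrix.of_apply, Fin.snoc_castSucc]
      field_simp
    simp only [Matrix.mulVec, dotProduct, Matrix.submatrix_apply, id, mul_sub, sum_sub_distrib,
      Pi.zero_apply]
    rw [h3]
    rw [← hφ, h2] at h1
    linarith

theorem gcd_eq_one_of_isUnit_dotProduct {n : ℕ} {a w : Fin n → ℤ} (h : IsUnit (w ⬝ᵥ a)) :
    univ.gcd a = 1 := by
  have h1 : univ.gcd a ∣ w ⬝ᵥ a := dvd_sum fun i _ => (gcd_dvd (mem_univ i)).mul_left _
  rw [← Finset.normalize_gcd]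
  exact normalize_eq_one.2 (isUnit_of_dvd_unit h1 h)

/-- Properties of a matrix close to `slopeMatrix b α`, in terms of its signed minors. -/
theorem eventually_slopeMatrix {b : Matrix (Fin d) (Fin d) ℝ} (hb : b.det ≠ 0) {α : Fin d → ℝ}
    (hα : ∀ j, 0 < α j) {σ : ℝ}
    (hσ : σ * signedMinors (slopeMatrix b α) (Fin.last d) =
      |signedMinors (slopeMatrix b α) (Fin.last d)|)
    {ε μ μ' θ : ℝ} (hε : 0 < ε) (hμ : 0 < μ) (hμ' : μ < μ') (hcov : Covers s b μ)
    (hθ : μ' < θ * |b.det| ^ (1 / (d : ℝ))) :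
    ∀ᶠ X in 𝓝 (slopeMatrix b α),
      (∀ j, 0 < σ * signedMinors X j) ∧
      (∀ j : Fin d, |α j - signedMinors X j.castSucc / signedMinors X (Fin.last d)| < ε) ∧
      Covers s (Matrix.of fun i (j : Fin d) =>
        signedMinors X j.castSucc / signedMinors X (Fin.last d) * X i j.castSucc) μ' ∧
      μ' < θ * ((∏ j : Fin d, signedMinors X j.castSucc / signedMinors X (Fin.last d)) *
        (σ * signedMinors X (Fin.last d))) ^ (1 / (d : ℝ)) := by
  set N := slopeMatrix b α with hN
  have hvol := abs_signedMinors_slopeMatrix_last (b := b) hα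
  have hratio := signedMinors_slopeMatrix_castSucc hb hα
  rw [← hN] at hvol hratio
  have hlast : signedMinors N (Fin.last d) ≠ 0 := fun h0 => by
    rw [h0, abs_zero, mul_zero] at hvol
    exact hb (abs_eq_zero.1 hvol.symm)
  -- At X = N the ratios are α, so the rescaled matrix is b and the volume term is |det b|. All four
  -- conditions hold there strictly or by stability, and extend to nearby X by continuity.
  have hdiv : ∀ j : Fin d, signedMinors N j.castSucc / signedMinors N (Fin.last d) = α j :=
    fun j => by rw [hratio, mul_div_cancel_right₀ _ hlast]
  have hφ : ∀ j, ContinuousAt (fun X => signedMinors X j) N := fun j =>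
    ((continuous_apply j).comp continuous_signedMinors).continuousAt
  have hq : ∀ j : Fin d, ContinuousAt
      (fun X => signedMinors X j.castSucc / signedMinors X (Fin.last d)) N :=
    fun j => (hφ _).div (hφ _) hlast
  have hentry : ∀ i j, ContinuousAt (fun X : Matrix (Fin d) (Fin (d + 1)) ℝ => X i j) N :=
    fun i j => (continuous_id.matrix_elem i j).continuousAt
  refine Filter.Eventually.and ?_ (Filter.Eventually.and ?_ (Filter.Eventually.and ?_ ?_))
  · refine eventually_all.2 fun j => continuousAt_const.eventually_lt
      (continuousAt_const.mul (hφ j)) ?_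
    have h0 : 0 < σ * signedMinors N (Fin.last d) := hσ ▸ abs_pos.2 hlast
    refine Fin.lastCases h0 (fun j => ?_) j
    rw [hratio, mul_left_comm]
    exact mul_pos (hα j) h0
  · refine eventually_all.2 fun j => (continuousAt_const.sub (hq j)).abs.eventually_lt
      continuousAt_const ?_
    change |α j - signedMinors N j.castSucc / signedMinors N (Fin.last d)| < ε
    rw [hdiv, sub_self, abs_zero]
    exact hε
  · have hlim : Tendsto (fun X => Matrix.of fun i (j : Fin d) =>
        signedMinors X j.castSucc / signedMinors X (Fin.last d) * X i j.castSucc) (𝓝 N)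
          (𝓝 b) := by
      refine tendsto_pi_nhds.2 fun i => tendsto_pi_nhds.2 fun j => ?_
      have h1 := (hq j).tendsto.mul (hentry i j.castSucc).tendsto
      rw [hdiv] at h1
      have h2 : α j * N i j.castSucc = b i j := by
        have := (hα j).ne'
        simp only [hN, slopeMatrix, Matrix.of_apply, Fin.snoc_castSucc]
        field_simp
      rwa [h2] at h1
    exact hlim.eventually (hcov.eventually hb hμ hμ')
  · have h1 : ContinuousAt (fun X : Matrix (Fin d) (Fin (d + 1)) ℝ =>
        (∏ j : Fin d, signedMinors X j.castSucc / signedMinors X (Fin.last d)) *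
          (σ * signedMinors X (Fin.last d))) N :=
      (tendsto_finsetProd _ fun j _ => hq j).mul (continuousAt_const.mul (hφ _))
    refine continuousAt_const.eventually_lt (continuousAt_const.mul
      (h1.rpow_const (Or.inr (by positivity)))) ?_
    simp only [hdiv]
    rw [hσ, hvol]
    exact hθ

theorem exists_frobeniusNumber_lt (hd : 1 ≤ d) (hs : 1 ≤ s) {ε : ℝ} (hε : 0 < ε) {α : Fin d → ℝ}
    (hα : ∀ i, 0 < α i) :
    ∃ a : Fin (d + 1) → ℤ, (∀ i, 0 < a i) ∧ univ.gcd a = 1 ∧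
      (∀ i : Fin d, |α i - (a i.castSucc : ℝ) / (a (Fin.last d) : ℝ)| < ε) ∧
      (frobeniusNumber s a + ∑ i, (a i : ℝ)) / (∏ i, (a i : ℝ)) ^ (1 / (d : ℝ)) <
        absInhomogeneousMinimum s (standardSimplex d) + ε := by
  set θ := absInhomogeneousMinimum s (standardSimplex d) + ε with hθ
  -- The lattice ℤᵈ serves only to show that the infimum is over a nonempty set.
  obtain ⟨_, ⟨L, hL1, hL2, rfl⟩, hr⟩ := exists_lt_of_csInf_lt (by
    exact ⟨_, Submodule.span ℤ (Set.range (Pi.basisFun ℝ (Fin d))), inferInstance, inferInstance,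
      rfl⟩) (show absInhomogeneousMinimum s (standardSimplex d) < θ from lt_add_of_pos_right _ hε)
  have hL0 : 0 < ZLattice.covolume L ^ (1 / (d : ℝ)) :=
    Real.rpow_pos_of_pos (ZLattice.covolume_pos L) _
  rw [div_lt_iff₀ hL0] at hr
  let B := IsZLattice.basis L
  obtain ⟨μ, hμ0, hμr, hcov⟩ := exists_covers_of_coveringRadius_lt hd B hr
  obtain ⟨μ', hμ', hμr'⟩ := exists_between hμr
  set b : Matrix (Fin d) (Fin d) ℝ := Matrix.of fun i => (B i : Fin d → ℝ) with hbdef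
  have hvol : ZLattice.covolume L = |b.det| := ZLattice.covolume_eq_det L B
  have hb : b.det ≠ 0 := abs_ne_zero.1 (hvol ▸ (ZLattice.covolume_pos L).ne')
  rw [hvol] at hμr'
  -- The minors share a common sign near the slope matrix; σ makes them positive.
  obtain ⟨σ, hσ1, hσ⟩ : ∃ σ : ℤ, σ * σ = 1 ∧
      (σ : ℝ) * signedMinors (slopeMatrix b α) (Fin.last d) =
        |signedMinors (slopeMatrix b α) (Fin.last d)| := by
    rcases abs_choice (signedMinors (slopeMatrix b α) (Fin.last d)) with h | h
    · exact ⟨1, by norm_num, by rw [h]; simp⟩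
    · exact ⟨-1, by norm_num, by rw [h]; simp⟩
  have hlast : signedMinors (slopeMatrix b α) (Fin.last d) ≠ 0 := fun h0 => by
    have h1 := abs_signedMinors_slopeMatrix_last (b := b) hα
    rw [h0, abs_zero, mul_zero] at h1
    exact hb (abs_eq_zero.1 h1.symm)
  obtain ⟨t, v, w, ht, hw, hpos, hclose, hcov', hsize⟩ := exists_primitive_approximation hlast
    (eventually_slopeMatrix hb hα hσ hε hμ0 hμ' hcov hμr')
  let a : Fin (d + 1) → ℤ := fun j => σ * signedMinors v j
  have hX : ∀ j, (σ : ℝ) * signedMinors (t⁻¹ • v.map (Int.castRingHom ℝ)) j =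
      (t⁻¹) ^ d * a j := fun j => by
    rw [signedMinors_smul, Pi.smul_apply, signedMinors_map]
    simp only [a, smul_eq_mul, Int.coe_castRingHom]
    push_cast
    ring
  have hσ0 : (σ : ℝ) ≠ 0 := by
    have : σ ≠ 0 := by rintro rfl; simp at hσ1
    exact_mod_cast this
  have htd : 0 < (t⁻¹) ^ d := by positivity
  have hratio : ∀ j, signedMinors (t⁻¹ • v.map (Int.castRingHom ℝ)) j /
      signedMinors (t⁻¹ • v.map (Int.castRingHom ℝ)) (Fin.last d) =
        (a j : ℝ) / a (Fin.last d) := fun j => by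
    rw [← mul_div_mul_left _ _ hσ0, hX, hX, mul_div_mul_left _ _ htd.ne']
  have haR : ∀ j, (0 : ℝ) < a j := fun j => by
    have := hpos j
    rw [hX] at this
    exact pos_of_mul_pos_right this htd.le
  have ha : ∀ j, 0 < a j := fun j => by exact_mod_cast haR j
  have haσ : a = σ • signedMinors v := rfl
  have hg : univ.gcd a = 1 := by
    refine gcd_eq_one_of_isUnit_dotProduct (w := w) ?_
    rw [haσ, dotProduct_smul, smul_eq_mul]
    exact (IsUnit.of_mul_eq_one _ hσ1).mul hw
  have hv : ∀ i, v i ⬝ᵥ a = 0 := fun i => by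
    rw [haσ, dotProduct_smul, row_dotProduct_signedMinors, smul_zero]
  have hdet : (v.submatrix id Fin.castSucc).det ≠ 0 := fun h0 => by
    have h1 := ha (Fin.last d)
    simp [haσ, signedMinors_last, h0] at h1
  refine ⟨a, ha, hg, fun i => ?_, ?_⟩
  · have := hclose i
    rwa [hratio] at this
  · have hm := haR (Fin.last d)
    have hP : (0 : ℝ) < ∏ i, (a i : ℝ) := prod_pos fun i _ => haR i
    rw [div_lt_iff₀ (Real.rpow_pos_of_pos hP _)]
    -- With c = m t, the factor c⁻¹aⱼ equals (aⱼ/m)t⁻¹, so the rescaled lattice rows are exactly the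
    -- matrix covered in `hcov'`; below, the volume term becomes ∏ aᵢ / cᵈ.
    have hF := Covers.frobeniusNumber_add_sum_le (c := a (Fin.last d) * t) (μ := μ') hd hs ha hg hv
      hdet (mul_pos hm ht) (by
        convert hcov' using 4 with i j
        rw [hratio]
        simp only [Matrix.smul_apply, Matrix.map_apply, smul_eq_mul, Int.coe_castRingHom]
        field_simp)
    refine hF.trans_lt ?_
    simp only [hratio, hX] at hsize
    have h1 : (∏ j : Fin d, (a j.castSucc : ℝ) / a (Fin.last d)) *
        ((t⁻¹) ^ d * a (Fin.last d)) = (∏ i, (a i : ℝ)) / (a (Fin.last d) * t) ^ d := by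
      rw [Fin.prod_univ_castSucc, prod_div_distrib, prod_const, card_univ, Fintype.card_fin,
        inv_pow, mul_pow]
      field_simp
    have h2 : (((a (Fin.last d) : ℝ) * t) ^ d) ^ (1 / (d : ℝ)) = a (Fin.last d) * t := by
      rw [one_div]
      exact Real.pow_rpow_inv_natCast (mul_pos hm ht).le (by omega)
    rw [h1, Real.div_rpow hP.le (by positivity), h2, ← mul_div_assoc,
      lt_div_iff₀ (mul_pos hm ht)] at hsize
    linarith

end Knapsack

theorem theorem1 (d s : ℕ) (hd : 2 ≤ d) (hs : 1 ≤ s) :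
    (∀ a : Fin (d + 1) → ℤ, (∀ i, 0 < a i) → Finset.univ.gcd a = 1 →
      IsGreatest (Knapsack.deficientSet s a) (Knapsack.frobeniusNumber s a) ∧
      (Knapsack.frobeniusNumber s a : ℝ) ≥
        Knapsack.absInhomogeneousMinimum s (Knapsack.standardSimplex d) *
          (∏ i, (a i : ℝ)) ^ (1 / (d : ℝ)) - ∑ i, (a i : ℝ)) ∧
    (∀ ε : ℝ, 0 < ε → ∀ α : Fin d → ℝ, (∀ i, 0 < α i) → Monotone α →
      ∃ a : Fin (d + 1) → ℤ, (∀ i, 0 < a i) ∧ Finset.univ.gcd a = 1 ∧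
        (∀ i : Fin d, |α i - (a i.castSucc : ℝ) / (a (Fin.last d) : ℝ)| < ε) ∧
        ((Knapsack.frobeniusNumber s a : ℝ) + ∑ i, (a i : ℝ)) /
            (∏ i, (a i : ℝ)) ^ (1 / (d : ℝ)) <
          Knapsack.absInhomogeneousMinimum s (Knapsack.standardSimplex d) + ε) := by
  have hd1 : 1 ≤ d := by omega
  exact ⟨fun a ha hg => ⟨Knapsack.isGreatest_frobeniusNumber hd1 hs ha hg,
    sub_le_iff_le_add.2 (Knapsack.absInhomogeneousMinimum_mul_le hd1 hs ha hg)⟩,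
    fun ε hε α hα _ => Knapsack.exists_frobeniusNumber_lt hd1 hs hε hα⟩
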